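/- Let $G=(V,E)$ be a complete undirected graph on a finite vertex set with metric edge lengths $c_e\ge 0$ and a root $r\in V$. For $S\subseteq V$ let $\delta(S)$ be the set of edges with exactly one endpoint in $S$, and $\delta(v)=\delta(\{v\})$. A pair $(x,y)\in\mathbb R^E\times\mathbb R^V$ is called feasible if $x\ge 0$, $y\ge 0$, $y_r=1$, $x(\delta(r))\le 2$, $x(\delta(v))=2y_v$ for all $v\in V\setminus\{r\}$, and $x(\delta(S))\ge 2y_v$ for all $S\subseteq V\setminus\{r\}$ and $v\in S$ (the linear programming relaxation of prize-collecting TSP). Let $\delta\in[0,1)$, $\kappa\in[\delta,1]$, and let $(x^*,y^*)$ be feasible (for example, optimal for the relaxation). Let $(x,y)$ be obtained from $(x^*,y^*)$ by performing, one after another, complete splittings at all vertices $v$ with $y^*_v<\delta$. Here a feasible splitting at $v$ decreases $x_{\{v,s\}}$, $x_{\{v,t\}}$ and $y_v$ by some $\varepsilon\ge0$ and increases $x_{\{s,t\}}$ by $\varepsilon$ in such a way that the result is feasible (if $s=t$, then $x_{\{v,s\}}$ decreases by $2\varepsilon$ and the loop is discarded); a complete splitting at $v$ is a finite sequence of feasible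 splittings at $v$ that ends with $y_v=0$. Let $\mathcal T$ be a finite set of trees in $G$, all containing $r$, with weights $\mu\in[0,1]^{\mathcal T}$ such that $\sum_{T\in\mathcal T}\mu_T=1$, $\sum_{T\in\mathcal T}\mu_T\chi^{E[T]}\le x$, and $\sum_{T\in\mathcal T:\,v\in V[T]}\mu_T=y_v$ for all $v\in V$. Let $T_0\in\mathcal T$ be random with $\mathbb P[T_0=T]=\mu_T$ for every $T\in\mathcal T$, and let $\gamma\in[\delta,\kappa]$ be random, independent of $T_0$, with $$\mathbb P[\gamma\le t]=\frac{3-\delta-\kappa}{3-\delta-t}\qquad\text{for all } t\in[\delta,\kappa].$$ Let $T=\operatorname{core}(T_0,\gamma)$ be the inclusion-wise minimal subtree of $T_0$ that spans all vertices $v\in V[T_0]$ with $y_v\ge\gamma$. Let $C$ be a (random) cycle obtained from $T$ by adding a shortest $\operatorname{odd}(T)$-join, i.e. a minimum-length edge set having odd degree exactly at the vertices of odd degree in $T$, and shortcutting an Eulerian walk in the resulting multigraph. (A cycle on two vertices $u,v$ has length $2c_{\{u,v\}}$, and a cycle on one vertex has length $0$.) Then $$\mathbb E\big[c(E[C])\big]\le\frac{7-2\delta-2\kappa}{3-\delta}\cdot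 c^\top x^*.$$ -/

import Mathlib

namespace PCTSP

open Finset

/-- Edge set of the complete graph on `V` (no loops). -/
def edges (V : Type*) [Fintype V] [DecidableEq V] : Finset (Sym2 V) :=
  univ.filter fun e => ¬ e.IsDiag

/-- Metric edge lengths: nonnegative, symmetric (they are indexed by unordered pairs) and satisfying
the triangle inequality; the distance of a vertex to itself is zero. -/
structure IsMetric {V : Type*} (c : Sym2 V → ℝ) : Prop where
  self : ∀ v, c s(v, v) = 0
  nonneg : ∀ e, 0 ≤ c e
  triangle : ∀ u v w, c s(u, w) ≤ c s(u, v) + c s(v, w)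

/-- `cᵀ x`. Only the values on `edges V` matter. -/
def cost {V : Type*} [Fintype V] [DecidableEq V] (c x : Sym2 V → ℝ) : ℝ :=
  ∑ e ∈ edges V, c e * x e

open Classical in
/-- `δ(S)`: the edges with exactly one endpoint in `S`. -/
noncomputable def cut {V : Type*} [Fintype V] [DecidableEq V] (S : Finset V) : Finset (Sym2 V) :=
  (edges V).filter fun e => ∃ u v, e = s(u, v) ∧ u ∈ S ∧ v ∉ S

/-- Feasibility of `(x, y)` for the linear programming relaxation of prize-collecting TSP
with root `r`. -/
structure Feasible {V : Type*} [Fintype V] [DecidableEq V] (r : V)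
    (x : Sym2 V → ℝ) (y : V → ℝ) : Prop where
  degree : ∀ v, v ≠ r → ∑ e ∈ cut {v}, x e = 2 * y v
  degree_root : ∑ e ∈ cut {r}, x e ≤ 2
  cuts : ∀ S : Finset V, r ∉ S → ∀ v ∈ S, 2 * y v ≤ ∑ e ∈ cut S, x e
  root : y r = 1
  nonneg_x : ∀ e ∈ edges V, 0 ≤ x e
  nonneg_y : ∀ v, 0 ≤ y v

/-- A feasible splitting at `v`: for some `ε ≥ 0`, the weight of the edges `{v,s}` and `{v,t}` is
decreased by `ε`, the weight of `{s,t}` is increased by `ε`, the value at `v` is decreased by `ε`,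
and the result is feasible. In the case `s = t` the new edge is a loop, which is discarded (values on
loops are never used); feasibility then only permits `s = t = r` or `ε = 0`. -/
def FeasibleSplitting {V : Type*} [Fintype V] [DecidableEq V] (r v : V)
    (p q : (Sym2 V → ℝ) × (V → ℝ)) : Prop :=
  ∃ (s t : V) (ε : ℝ), s ≠ v ∧ t ≠ v ∧ 0 ≤ ε ∧
    q.1 = p.1 - Pi.single s(v, s) ε - Pi.single s(v, t) ε + Pi.single s(s, t) ε ∧
    q.2 = p.2 - Pi.single v ε ∧
    Feasible r q.1 q.2

/-- A complete splitting at `v`: a sequence of feasible splittings at `v` that results in `y v = 0`. -/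
def CompleteSplitting {V : Type*} [Fintype V] [DecidableEq V] (r v : V)
    (p q : (Sym2 V → ℝ) × (V → ℝ)) : Prop :=
  Relation.ReflTransGen (FeasibleSplitting r v) p q ∧ q.2 v = 0

/-- Complete splittings performed one after another at the vertices of a list. -/
inductive CompleteSplittings {V : Type*} [Fintype V] [DecidableEq V] (r : V) :
    List V → (Sym2 V → ℝ) × (V → ℝ) → (Sym2 V → ℝ) × (V → ℝ) → Prop
  | nil (p) : CompleteSplittings r [] p p
  | cons {v l p q q'} : CompleteSplitting r v p q → CompleteSplittings r l q q' →
      CompleteSplittings r (v :: l) p q'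

/-- `(x, y)` arises from `(x', y')` by complete splittings, in some order, at all vertices whose
value is smaller than `δ`. -/
def ObtainedBySplitting {V : Type*} [Fintype V] [DecidableEq V] (r : V) (δ : ℝ)
    (x' : Sym2 V → ℝ) (y' : V → ℝ) (x : Sym2 V → ℝ) (y : V → ℝ) : Prop :=
  ∃ l : List V, l.Nodup ∧ (∀ v, v ∈ l ↔ y' v < δ) ∧ CompleteSplittings r l (x', y') (x, y)

/-- Subgraphs of the complete graph on `V`. -/
abbrev Subgr (V : Type*) := (⊤ : SimpleGraph V).Subgraph

/-- Subgraph-valued random variables are discrete. -/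
instance instMeasurableSpaceSubgr (V : Type*) : MeasurableSpace (Subgr V) := ⊤

open Classical in
/-- `(𝒯, μ)` is a decomposition of `(x, y)` into trees containing the root `r`. -/
structure IsTreeDecomposition {V : Type*} [Fintype V] [DecidableEq V] (r : V)
    (x : Sym2 V → ℝ) (y : V → ℝ) (𝒯 : Finset (Subgr V)) (μ : Subgr V → ℝ) : Prop where
  isTree : ∀ T ∈ 𝒯, T.coe.IsTree
  root_mem : ∀ T ∈ 𝒯, r ∈ T.verts
  mem_Icc : ∀ T ∈ 𝒯, μ T ∈ Set.Icc (0 : ℝ) 1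
  sum_eq_one : ∑ T ∈ 𝒯, μ T = 1
  edge_le : ∀ e ∈ edges V, ∑ T ∈ 𝒯 with e ∈ T.edgeSet, μ T ≤ x e
  vert_eq : ∀ v, ∑ T ∈ 𝒯 with v ∈ T.verts, μ T = y v

/-- `T' = core(T, γ)` with respect to `y`: `T'` is the inclusion-wise minimal subtree of `T` that
spans all vertices `v` of `T` with `y v ≥ γ`. -/
def IsCore {V : Type*} (y : V → ℝ) (T : Subgr V) (γ : ℝ) (T' : Subgr V) : Prop :=
  Minimal (fun H : Subgr V => H ≤ T ∧ H.coe.IsTree ∧ ∀ v ∈ T.verts, γ ≤ y v → v ∈ H.verts) T'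

open Classical in
/-- The edges of a subgraph, as a finite set. -/
noncomputable def subEdges {V : Type*} [Fintype V] [DecidableEq V] (T : Subgr V) :
    Finset (Sym2 V) :=
  univ.filter fun e => e ∈ T.edgeSet

/-- The vertices of odd degree with respect to a set of edges. -/
def oddVerts {V : Type*} [Fintype V] [DecidableEq V] (F : Finset (Sym2 V)) : Finset V :=
  univ.filter fun v => Odd (#{e ∈ F | v ∈ e})

/-- A `Q`-join: a set of edges that has odd degree precisely at the vertices in `Q`. -/
def IsJoin {V : Type*} [Fintype V] [DecidableEq V] (Q : Finset V) (J : Finset (Sym2 V)) : Prop :=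
  J ⊆ edges V ∧ oddVerts J = Q

/-- A shortest `Q`-join. -/
def IsShortestJoin {V : Type*} [Fintype V] [DecidableEq V] (c : Sym2 V → ℝ) (Q : Finset V)
    (J : Finset (Sym2 V)) : Prop :=
  IsJoin Q J ∧ ∀ J', IsJoin Q J' → ∑ e ∈ J, c e ≤ ∑ e ∈ J', c e

/-- Length of the cycle that visits the vertices of `C` in this order and returns to the first one.
For two vertices `u, v` this is `2 c(u, v)`; for one vertex it is `c(v, v) = 0`. -/
def cycleLength {V : Type*} (c : Sym2 V → ℝ) (C : List V) : ℝ :=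
  (List.zipWith (fun u v => c s(u, v)) C (C.rotate 1)).sum

/-- `C` is a cycle obtained from the tree `T` by parity correction and shortcutting: there are a
shortest `odd(T)`-join `J` and an Eulerian walk `w` of the multigraph `T + J` (a closed walk that uses
every edge exactly as often as it occurs in `T + J` and visits all vertices), and `C` arises from the
vertex sequence of `w` by keeping exactly one occurrence of each vertex. -/
def IsCorrectedCycle {V : Type*} [Fintype V] [DecidableEq V] (c : Sym2 V → ℝ) (T : Subgr V)
    (C : List V) : Prop :=
  ∃ (J : Finset (Sym2 V)) (u : V) (w : (⊤ : SimpleGraph V).Walk u u),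
    IsShortestJoin c (oddVerts (subEdges T)) J ∧
    (w.edges : Multiset (Sym2 V)) = (subEdges T).val + J.val ∧
    (∀ v ∈ T.verts, v ∈ w.support) ∧
    C.Sublist w.support ∧ C.Nodup ∧ ∀ v ∈ w.support, v ∈ C

end PCTSP

/-!
By the Edmonds–Johnson theorem, a vector `z ≥ 0` that has total weight at least `1` on every cut
`δ(S)` with `|Q ∩ S|` odd costs at least as much as a shortest `Q`-join. For the core `T` and
`Q = odd(T)` this applies to `z = x / (3 - δ) + ∑ (1 - 2 bₑ / (3 - δ)) χᵉ`, the sum being over the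
edges `e` of `T`, where `bₑ` is the largest value of `y` on the side of `e` in `T₀` away from the
root: a cut containing exactly one edge `e` of `T` separates a vertex of value `bₑ` from the root,
hence has `x`-weight at least `2 bₑ`, and a cut containing at least three edges of `T` has
`x`-weight at least `2 δ`, because vertices of value less than `δ` have been split off.

Altogether the cycle costs at most `c(x) / (3 - δ)` plus a price `(2 - 2 bₑ / (3 - δ)) c(e)` for
each edge of the core. An edge `e` of `T₀` belongs to the core only if `γ ≤ bₑ`, and the law of `γ`
is such that this price, multiplied by `ℙ[γ ≤ bₑ]`, is at most `2 (3 - δ - κ) / (3 - δ) · c(e)`.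
-/

namespace PCTSP

open Finset MeasureTheory

open scoped symmDiff

section Joins

variable {V : Type*} [Fintype V] [DecidableEq V] {D Q Q' : Finset V} {F J J' : Finset (Sym2 V)}

lemma mk_mem_edges {u v : V} : s(u, v) ∈ edges V ↔ u ≠ v := by
  simp [edges]

lemma mk_mem_cut {S : Finset V} {u v : V} : s(u, v) ∈ cut S ↔ ¬ (u ∈ S ↔ v ∈ S) := by
  simp only [cut, mem_filter, mk_mem_edges, Sym2.eq_iff]
  grind

lemma cut_subset_edges (S : Finset V) : cut S ⊆ edges V := filter_subset _ _

lemma cut_compl (S : Finset V) : cut Sᶜ = cut S := by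
  ext ⟨u, v⟩
  simp only [mk_mem_cut, mem_compl, not_iff_not]

lemma exists_eq_mk_of_mem_cut {e : Sym2 V} (he : e ∈ cut D) : ∃ a ∈ D, ∃ b ∉ D, e = s(a, b) := by
  simp only [cut, mem_filter] at he
  grind

lemma mem_oddVerts {v : V} : v ∈ oddVerts F ↔ Odd #{e ∈ F | v ∈ e} := by
  simp [oddVerts]

lemma odd_card_symmDiff {α : Type*} [DecidableEq α] (A B : Finset α) :
    Odd #(A ∆ B) ↔ ¬ (Odd #A ↔ Odd #B) := by
  have h : #(A ∆ B) = #(A \ B) + #(B \ A) := card_union_of_disjoint disjoint_sdiff_sdiff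
  have hA := card_sdiff_add_card_inter A B
  have hB := card_sdiff_add_card_inter B A
  rw [inter_comm B A] at hB
  simp only [Nat.odd_iff]
  omega

lemma oddVerts_symmDiff (F G : Finset (Sym2 V)) :
    oddVerts (F ∆ G) = oddVerts F ∆ oddVerts G := by
  ext v
  have h : ({e ∈ F ∆ G | v ∈ e} : Finset _) = {e ∈ F | v ∈ e} ∆ {e ∈ G | v ∈ e} := by
    ext e
    simp only [mem_filter, mem_symmDiff]
    tauto
  simp only [mem_symmDiff, mem_oddVerts, h, odd_card_symmDiff]
  tauto

lemma oddVerts_singleton {u v : V} (h : u ≠ v) : oddVerts {s(u, v)} = ({u} : Finset V) ∆ {v} := by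
  ext w
  rw [mem_oddVerts, filter_singleton]
  split_ifs with hw <;> simp [mem_symmDiff] at hw ⊢ <;> grind

lemma odd_card_filter_mem_iff_mem_cut {e : Sym2 V} (he : e ∈ edges V) (S : Finset V) :
    Odd #{v ∈ S | v ∈ e} ↔ e ∈ cut S := by
  induction e with | _ u v =>
  have huv := mk_mem_edges.1 he
  have h : ({w ∈ S | w ∈ s(u, v)} : Finset V) = {w ∈ ({u, v} : Finset V) | w ∈ S} := by
    ext w
    simp [and_comm]
  rw [h, mk_mem_cut, filter_insert, filter_singleton]
  split_ifs <;> simp_all [Nat.not_odd_iff_even]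

lemma odd_card_inter_cut (hF : F ⊆ edges V) (S : Finset V) :
    Odd #(F ∩ cut S) ↔ Odd #(oddVerts F ∩ S) := by
  have hcut : F ∩ cut S = {e ∈ F | Odd #{v ∈ S | v ∈ e}} := by
    ext e
    simp only [mem_inter, mem_filter]
    exact and_congr_right fun he => (odd_card_filter_mem_iff_mem_cut (hF he) S).symm
  have hodd : oddVerts F ∩ S = {v ∈ S | Odd #{e ∈ F | v ∈ e}} := by
    ext v
    simp only [mem_inter, mem_filter, mem_oddVerts, and_comm]
  have hcount : ∑ e ∈ F, #{v ∈ S | v ∈ e} = ∑ v ∈ S, #{e ∈ F | v ∈ e} :=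
    (sum_card_bipartiteAbove_eq_sum_card_bipartiteBelow fun (v : V) (e : Sym2 V) => v ∈ e).symm
  rw [hcut, hodd, ← odd_sum_iff_odd_card_odd, ← odd_sum_iff_odd_card_odd, hcount]

lemma IsJoin.symmDiff (h : IsJoin Q J) (h' : IsJoin Q' J') : IsJoin (Q ∆ Q') (J ∆ J') :=
  ⟨fun _ he => (mem_symmDiff.1 he).elim (fun he => h.1 he.1) fun he => h'.1 he.1,
    by rw [oddVerts_symmDiff, h.2, h'.2]⟩

lemma isJoin_empty : IsJoin (∅ : Finset V) ∅ :=
  ⟨empty_subset _, by ext; simp [mem_oddVerts]⟩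

lemma isJoin_edge {u v : V} (h : u ≠ v) : IsJoin (({u} : Finset V) ∆ {v}) {s(u, v)} :=
  ⟨by simpa using mk_mem_edges.2 h, oddVerts_singleton h⟩

lemma IsJoin.exists_mk_mem {x d : V} (hxd : x ≠ d) (hF : IsJoin (({x} : Finset V) ∆ {d}) F) :
    ∃ z, s(x, z) ∈ F := by
  have hx : x ∈ oddVerts F := by simp [hF.2, mem_symmDiff, hxd]
  obtain ⟨e, he⟩ := card_pos.1 (mem_oddVerts.1 hx).pos
  obtain ⟨heF, z, rfl⟩ := mem_filter.1 he
  exact ⟨z, heF⟩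

/- Follow the join from `x` edge by edge until it enters `D`. -/
lemma IsJoin.exists_subset_entering {d : V} (hd : d ∈ D) {x : V} (hx : x ∉ D)
    (hF : IsJoin (({x} : Finset V) ∆ {d}) F) :
    ∃ a ∈ D, ∃ P ⊆ F, IsJoin (({x} : Finset V) ∆ {a}) P ∧ #(P ∩ cut D) = 1 := by
  induction hn : #F generalizing x F with
  | zero =>
    obtain ⟨z, hz⟩ := hF.exists_mk_mem (ne_of_mem_of_not_mem hd hx).symm
    simp_all
  | succ n ih =>
    obtain ⟨z, hz⟩ := hF.exists_mk_mem (ne_of_mem_of_not_mem hd hx).symm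
    have hxz : x ≠ z := mk_mem_edges.1 (hF.1 hz)
    by_cases hzD : z ∈ D
    · have hcut : s(x, z) ∈ cut D := by simp [mk_mem_cut, hx, hzD]
      exact ⟨z, hzD, {s(x, z)}, by simpa using hz, isJoin_edge hxz,
        by rw [singleton_inter_of_mem hcut, card_singleton]⟩
    · have hrest : IsJoin (({z} : Finset V) ∆ {d}) (F.erase s(x, z)) := by
        convert hF.symmDiff (isJoin_edge hxz) using 1 <;> grind [mem_symmDiff]
      obtain ⟨a, ha, P, hP, hPa, hPD⟩ := ih hzD hrest (by rw [card_erase_of_mem hz, hn]; rfl)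
      have hzP : s(x, z) ∉ P := fun h => notMem_erase _ _ (hP h)
      refine ⟨a, ha, insert s(x, z) P, insert_subset hz (hP.trans (erase_subset _ _)), ?_, ?_⟩
      · convert (isJoin_edge hxz).symmDiff hPa using 1 <;> grind [mem_symmDiff]
      · rw [insert_inter_of_notMem (by simp [mk_mem_cut, hx, hzD]), hPD]

end Joins

section Exchange

variable {α : Type*} [DecidableEq α] {A B P Z : Finset α}

lemma sum_symmDiff_add_sum_symmDiff (c : α → ℝ) (hP : P ⊆ A ∆ B) :
    ∑ e ∈ A ∆ P, c e + ∑ e ∈ B ∆ P, c e = ∑ e ∈ A, c e + ∑ e ∈ B, c e := by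
  have hunion : (A ∆ P) ∪ (B ∆ P) = A ∪ B := by grind [mem_symmDiff]
  have hinter : (A ∆ P) ∩ (B ∆ P) = A ∩ B := by grind [mem_symmDiff]
  rw [← sum_union_inter, hunion, hinter, sum_union_inter]

lemma sum_symmDiff_of_eq_zero {c : α → ℝ} (hZ : ∀ e ∈ Z, c e = 0) :
    ∑ e ∈ A ∆ Z, c e = ∑ e ∈ A, c e := by
  have h : {e ∈ A ∆ Z | c e ≠ 0} = {e ∈ A | c e ≠ 0} := by grind [mem_symmDiff]
  rw [← sum_filter_ne_zero, h, sum_filter_ne_zero]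

end Exchange

section CheapestShift

variable {V : Type*} [Fintype V] [DecidableEq V] {c : Sym2 V → ℝ} {Q : Finset V}
  {a b d x : V} {J K : Finset (Sym2 V)}

/-- Two vertices are zero-joined if they are joined by edges of weight zero, i.e. identified after
contracting these edges. -/
def ZeroJoined (c : Sym2 V → ℝ) (a b : V) : Prop :=
  ∃ Z, IsJoin (({a} : Finset V) ∆ {b}) Z ∧ ∀ e ∈ Z, c e = 0

lemma ZeroJoined.refl (c : Sym2 V → ℝ) (a : V) : ZeroJoined c a a :=
  ⟨∅, by simpa using isJoin_empty, by simp⟩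

lemma ZeroJoined.symm (h : ZeroJoined c a b) : ZeroJoined c b a := by
  obtain ⟨Z, hZ, hZ₀⟩ := h
  exact ⟨Z, symmDiff_comm ({a} : Finset V) {b} ▸ hZ, hZ₀⟩

lemma ZeroJoined.trans (hab : ZeroJoined c a b) (hbd : ZeroJoined c b d) : ZeroJoined c a d := by
  obtain ⟨Z, hZ, hZ₀⟩ := hab
  obtain ⟨Z', hZ', hZ'₀⟩ := hbd
  refine ⟨Z ∆ Z', ?_, by grind [mem_symmDiff]⟩
  convert hZ.symmDiff hZ' using 1
  grind [mem_symmDiff]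

lemma zeroJoined_of_edge (h : c s(a, b) = 0) : ZeroJoined c a b := by
  rcases eq_or_ne a b with rfl | hab
  · exact .refl c a
  · exact ⟨{s(a, b)}, isJoin_edge hab, by simpa using h⟩

open Classical in
/-- The vertices that are identified with `d` when all edges of weight zero are contracted. -/
noncomputable def zeroClass (c : Sym2 V → ℝ) (d : V) : Finset V :=
  {v | ZeroJoined c d v}

lemma mem_zeroClass : a ∈ zeroClass c d ↔ ZeroJoined c d a := by
  simp [zeroClass]

lemma zeroClass_eq (h : ZeroJoined c d a) : zeroClass c a = zeroClass c d := by
  ext v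
  simp only [mem_zeroClass]
  exact ⟨h.trans, h.symm.trans⟩

lemma pos_of_mem_cut_zeroClass (hc : 0 ≤ c) {e : Sym2 V} (he : e ∈ cut (zeroClass c d)) :
    0 < c e := by
  obtain ⟨a, ha, b, hb, rfl⟩ := exists_eq_mk_of_mem_cut he
  rw [mem_zeroClass] at ha hb
  exact (hc _).lt_of_ne fun h => hb (ha.trans (zeroJoined_of_edge h.symm))

/-- `K` is a `Q ∆ {x, d}`-join, and no `Q ∆ {x, d'}`-join is cheaper, whatever `d'` is: moving
the odd vertex `x` elsewhere, at will, leads to a join at least as expensive as `K`. -/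
def IsCheapestShift (c : Sym2 V → ℝ) (Q : Finset V) (x d : V) (K : Finset (Sym2 V)) : Prop :=
  IsJoin (Q ∆ (({x} : Finset V) ∆ {d})) K ∧
    ∀ d' K', IsJoin (Q ∆ (({x} : Finset V) ∆ {d'})) K' → ∑ e ∈ K, c e ≤ ∑ e ∈ K', c e

lemma exists_isCheapestShift (c : Sym2 V → ℝ) (x : V) (hJ : IsJoin Q J) :
    ∃ d K, IsCheapestShift c Q x d K := by
  obtain ⟨⟨d, K⟩, hK, hmin⟩ := Set.exists_min_image
    {p : V × Finset (Sym2 V) | IsJoin (Q ∆ (({x} : Finset V) ∆ {p.1})) p.2}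
    (fun p => ∑ e ∈ p.2, c e) (Set.toFinite _) ⟨(x, J), by simpa [← bot_eq_empty] using hJ⟩
  exact ⟨d, K, hK, fun d' K' hK' => hmin (d', K') hK'⟩

lemma IsJoin.move_zeroJoined (h : ZeroJoined c a b) (hK : IsJoin (Q ∆ {a}) K) :
    ∃ K', IsJoin (Q ∆ {b}) K' ∧ ∑ e ∈ K', c e = ∑ e ∈ K, c e ∧
      ∀ e ∈ K, c e ≠ 0 → e ∈ K' := by
  obtain ⟨Z, hZ, hZ₀⟩ := h
  refine ⟨K ∆ Z, ?_, sum_symmDiff_of_eq_zero hZ₀, by grind [mem_symmDiff]⟩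
  convert hK.symmDiff hZ using 1
  grind [mem_symmDiff]

lemma IsCheapestShift.disjoint_cut (hc : 0 ≤ c) (hK : IsCheapestShift c Q x d K) :
    Disjoint K (cut (zeroClass c d)) := by
  rw [disjoint_left]
  intro e heK he
  have hpos := pos_of_mem_cut_zeroClass hc he
  obtain ⟨a, ha, b, hb, rfl⟩ := exists_eq_mk_of_mem_cut he
  have hab : a ≠ b := ne_of_mem_of_not_mem ha hb
  rw [mem_zeroClass] at ha
  have hKd : IsJoin ((Q ∆ {x}) ∆ {d}) K := by rw [symmDiff_assoc]; exact hK.1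
  obtain ⟨K', hK', hsum, hmem⟩ := hKd.move_zeroJoined ha
  have heK' := hmem _ heK hpos.ne'
  have hshift : IsJoin (Q ∆ (({x} : Finset V) ∆ {b})) (K'.erase s(a, b)) := by
    convert hK'.symmDiff (isJoin_edge hab) using 1 <;> grind [mem_symmDiff]
  have := hK.2 b _ hshift
  have := add_sum_erase K' c heK'
  linarith

lemma IsCheapestShift.notMem_zeroClass (hK : IsCheapestShift c Q x d K)
    (hcheap : ∀ J, IsJoin Q J → ∑ e ∈ K, c e < ∑ e ∈ J, c e) : x ∉ zeroClass c d := by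
  rw [mem_zeroClass]
  intro hx
  have hKd : IsJoin ((Q ∆ {x}) ∆ {d}) K := by rw [symmDiff_assoc]; exact hK.1
  obtain ⟨J, hJ, hsum, -⟩ := hKd.move_zeroJoined hx
  rw [symmDiff_symmDiff_cancel_right] at hJ
  exact (hcheap J hJ).ne' hsum

/- Exchanging along the part of `J ∆ K` that leads from `x` into the zero class turns `J` into
another cheapest shift, which does not cross the cut. -/
lemma IsCheapestShift.card_inter_cut_eq_one (hc : 0 ≤ c) (hK : IsCheapestShift c Q x d K)
    (hx : x ∉ zeroClass c d) (hJ : IsShortestJoin c Q J) :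
    #(J ∩ cut (zeroClass c d)) = 1 := by
  have hJK : IsJoin (({x} : Finset V) ∆ {d}) (J ∆ K) := by
    simpa using hJ.1.symmDiff hK.1
  obtain ⟨a, ha, P, hP, hPa, hPD⟩ :=
    hJK.exists_subset_entering (mem_zeroClass.2 (.refl c d)) hx
  rw [mem_zeroClass] at ha
  have hJP : IsJoin (Q ∆ (({x} : Finset V) ∆ {a})) (J ∆ P) := hJ.1.symmDiff hPa
  have hKP : IsJoin ((Q ∆ {a}) ∆ {d}) (K ∆ P) := by
    convert hK.1.symmDiff hPa using 1
    grind [mem_symmDiff]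
  obtain ⟨J', hJ', hsum, -⟩ := hKP.move_zeroJoined ha
  rw [symmDiff_symmDiff_cancel_right] at hJ'
  have hexchange := sum_symmDiff_add_sum_symmDiff c hP
  have hJP_cheapest : IsCheapestShift c Q x a (J ∆ P) :=
    ⟨hJP, fun d' K' hK' => by linarith [hJ.2 J' hJ', hK.2 d' K' hK']⟩
  have hdisj := hJP_cheapest.disjoint_cut hc
  rw [zeroClass_eq ha, disjoint_left] at hdisj
  have heq : J ∩ cut (zeroClass c d) = P ∩ cut (zeroClass c d) := by grind [mem_symmDiff]
  rw [heq, hPD]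

lemma exists_cut_crossed_once (hc : 0 ≤ c) (hJ : IsShortestJoin c Q J)
    (hpos : 0 < ∑ e ∈ J, c e) :
    ∃ D : Finset V, (∀ e ∈ cut D, 0 < c e) ∧
      ∀ J', IsShortestJoin c Q J' → #(J' ∩ cut D) = 1 := by
  obtain ⟨e, he, hce⟩ := exists_lt_of_sum_lt (by simpa using hpos : ∑ e ∈ J, 0 < ∑ e ∈ J, c e)
  induction e with | _ x v =>
  obtain ⟨d, K, hK⟩ := exists_isCheapestShift c x hJ.1
  have hshift : IsJoin (Q ∆ (({x} : Finset V) ∆ {v})) (J.erase s(x, v)) := by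
    convert hJ.1.symmDiff (isJoin_edge (mk_mem_edges.1 (hJ.1.1 he))) using 1
    grind [mem_symmDiff]
  have hcheap : ∑ e ∈ K, c e < ∑ e ∈ J, c e := by
    linarith [hK.2 v _ hshift, add_sum_erase J c he]
  have hx := hK.notMem_zeroClass fun J' hJ' => hcheap.trans_le (hJ.2 J' hJ')
  exact ⟨zeroClass c d, fun e he => pos_of_mem_cut_zeroClass hc he,
    fun J' hJ' => hK.card_inter_cut_eq_one hc hx hJ'⟩

end CheapestShift

section Duality

open Filter Topology

variable {V : Type*} [Fintype V] [DecidableEq V] {c z : Sym2 V → ℝ} {Q D : Finset V}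
  {J : Finset (Sym2 V)}

lemma exists_isShortestJoin (c : Sym2 V → ℝ) (hJ : IsJoin Q J) :
    ∃ J', IsShortestJoin c Q J' := by
  obtain ⟨J', hJ', hmin⟩ := Set.exists_min_image {J | IsJoin Q J} (fun J => ∑ e ∈ J, c e)
    (Set.toFinite _) ⟨J, hJ⟩
  exact ⟨J', hJ', hmin⟩

lemma sum_sub_ite_mem {α : Type*} [DecidableEq α] (F X : Finset α) (w z : α → ℝ) (ε : ℝ) :
    ∑ e ∈ F, (w e - if e ∈ X then ε else 0) * z e =
      ∑ e ∈ F, w e * z e - ε * ∑ e ∈ F ∩ X, z e := by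
  simp only [sub_mul, ite_mul, zero_mul, sum_sub_distrib, sum_ite_mem, mul_sum]

/- A join that is not shortest stays strictly longer than `m` for small `ε`, however often it
crosses the cut. -/
lemma eventually_le_sum_sub_ite (hJ : IsShortestJoin c Q J)
    (hD : ∀ J', IsShortestJoin c Q J' → #(J' ∩ cut D) = 1) {J' : Finset (Sym2 V)}
    (hJ' : IsJoin Q J') :
    ∀ᶠ ε in 𝓝[>] (0 : ℝ),
      ∑ e ∈ J, c e - ε ≤ ∑ e ∈ J', (c e - if e ∈ cut D then ε else 0) := by
  have hsum (ε : ℝ) : ∑ e ∈ J', (c e - if e ∈ cut D then ε else 0) =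
      ∑ e ∈ J', c e - ε * #(J' ∩ cut D) := by
    simpa using sum_sub_ite_mem J' (cut D) c 1 ε
  simp only [hsum]
  rcases (hJ.2 J' hJ').eq_or_lt with heq | hlt
  · have hshort : IsShortestJoin c Q J' := ⟨hJ', heq ▸ hJ.2⟩
    simp [hD J' hshort, heq]
  · have hlim : Tendsto (fun ε : ℝ => (∑ e ∈ J', c e - ε * #(J' ∩ cut D)) - (∑ e ∈ J, c e - ε))
        (𝓝 0) (𝓝 (∑ e ∈ J', c e - ∑ e ∈ J, c e)) :=
      Continuous.tendsto' (by fun_prop) _ _ (by simp)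
    have h := hlim.eventually_const_lt (sub_pos.2 hlt)
    filter_upwards [nhdsWithin_le_nhds h] with ε hε
    exact (sub_pos.1 hε).le

lemma exists_reduction_on_cut (hc : 0 ≤ c) (hJ : IsShortestJoin c Q J)
    (hpos : 0 < ∑ e ∈ J, c e) :
    ∃ D : Finset V, (cut D).Nonempty ∧ Odd #(Q ∩ D) ∧ ∃ ε > 0, (∀ e ∈ cut D, ε ≤ c e) ∧
      ∀ J', IsJoin Q J' →
        ∑ e ∈ J, c e - ε ≤ ∑ e ∈ J', (c e - if e ∈ cut D then ε else 0) := by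
  obtain ⟨D, hDpos, hD⟩ := exists_cut_crossed_once hc hJ hpos
  have hodd : Odd #(Q ∩ D) := by
    rw [← hJ.1.2, ← odd_card_inter_cut hJ.1.1, hD J hJ]
    exact odd_one
  have hne : (cut D).Nonempty :=
    (card_pos.1 (by rw [hD J hJ]; exact one_pos)).mono inter_subset_right
  have hsmall : ∀ᶠ ε in 𝓝[>] (0 : ℝ), ∀ e ∈ cut D, ε ≤ c e :=
    (eventually_all_finset _).2 fun e he =>
      nhdsWithin_le_nhds ((eventually_lt_nhds (hDpos e he)).mono fun _ => le_of_lt)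
  have hjoins : ∀ᶠ ε in 𝓝[>] (0 : ℝ), ∀ J', IsJoin Q J' →
      ∑ e ∈ J, c e - ε ≤ ∑ e ∈ J', (c e - if e ∈ cut D then ε else 0) :=
    (Set.toFinite {J' | IsJoin Q J'}).eventually_all.2 fun J' hJ' =>
      eventually_le_sum_sub_ite hJ hD hJ'
  obtain ⟨ε, hε, hεc, hεJ⟩ := (eventually_mem_nhdsWithin.and (hsmall.and hjoins)).exists
  exact ⟨D, hne, hodd, ε, hε, hεc, hεJ⟩

/- Among the weights `0 ≤ w ≤ c` that violate the inequality by as much as `c` does, one of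
minimum total weight could still be reduced on a cut. -/
theorem IsShortestJoin.sum_le_cost_of_covers_cuts (hc : 0 ≤ c) (hJ : IsShortestJoin c Q J)
    (hz₀ : ∀ e ∈ edges V, 0 ≤ z e)
    (hz : ∀ S : Finset V, Odd #(Q ∩ S) → 1 ≤ ∑ e ∈ cut S, z e) :
    ∑ e ∈ J, c e ≤ cost c z := by
  by_contra! hlt
  obtain ⟨t, ht, hct⟩ : ∃ t > 0, cost c z + t = ∑ e ∈ J, c e :=
    ⟨∑ e ∈ J, c e - cost c z, sub_pos.2 hlt, by ring⟩
  let W : Set (Sym2 V → ℝ) :=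
    Set.Icc 0 c ∩ {w | ∀ J', IsJoin Q J' → cost w z + t ≤ ∑ e ∈ J', w e}
  have hWcompact : IsCompact W := by
    refine isCompact_Icc.inter_right ?_
    simp only [Set.ofPred_forall, cost]
    exact isClosed_iInter fun J' => isClosed_iInter fun _ => isClosed_le (by fun_prop) (by fun_prop)
  have hcW : c ∈ W := ⟨⟨hc, le_rfl⟩, fun J' hJ' => hct.trans_le (hJ.2 J' hJ')⟩
  obtain ⟨w, ⟨⟨hw₀, hwc⟩, hw⟩, hmin⟩ := hWcompact.exists_isMinOn ⟨c, hcW⟩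
    (f := fun w => ∑ e, w e) (by fun_prop)
  obtain ⟨K, hK⟩ := exists_isShortestJoin w hJ.1
  have hcost₀ : 0 ≤ cost w z := sum_nonneg fun e he => mul_nonneg (hw₀ e) (hz₀ e he)
  have hKpos : 0 < ∑ e ∈ K, w e := by linarith [hw K hK.1]
  obtain ⟨D, hne, hodd, ε, hε, hεw, hεJ⟩ := exists_reduction_on_cut hw₀ hK hKpos
  let w' : Sym2 V → ℝ := fun e => w e - if e ∈ cut D then ε else 0
  have hw'₀ : 0 ≤ w' := fun e => by
    simp only [w', Pi.zero_apply]
    split_ifs with he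
    · linarith [hεw e he]
    · simpa using hw₀ e
  have hw'w : w' ≤ w := fun e => sub_le_self _ (by split_ifs <;> linarith)
  have hcost : cost w' z + ε ≤ cost w z := by
    have h := sum_sub_ite_mem (edges V) (cut D) w z ε
    rw [inter_eq_right.2 (cut_subset_edges D)] at h
    have := mul_le_mul_of_nonneg_left (hz D hodd) hε.le
    simp only [cost, w', h]
    linarith
  have hw'W : w' ∈ W :=
    ⟨⟨hw'₀, hw'w.trans hwc⟩, fun J' hJ' => by linarith [hεJ J' hJ', hw K hK.1]⟩
  obtain ⟨e, he⟩ := hne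
  have hsum : ∑ e, w' e < ∑ e, w e :=
    sum_lt_sum (fun e _ => hw'w e) ⟨e, mem_univ e, by simpa [w', he] using hε⟩
  exact hsum.not_ge (hmin hw'W)

end Duality

section ParityCorrection

variable {V : Type*} [DecidableEq V] {c x b : Sym2 V → ℝ} {F J : Finset (Sym2 V)} {δ : ℝ}

/-- The vector `x / (3 - δ) + χ^F (1 - 2 b / (3 - δ))`, which covers the odd cuts of `F`. -/
noncomputable def parityCorrection (δ : ℝ) (x b : Sym2 V → ℝ) (F : Finset (Sym2 V)) :
    Sym2 V → ℝ :=
  fun e => 1 / (3 - δ) * x e + if e ∈ F then 1 - 2 * b e / (3 - δ) else 0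

lemma le_one_sub_two_mul_div {t : ℝ} (hδ : δ ≤ 1) (ht : t ≤ 1) :
    (1 - δ) / (3 - δ) ≤ 1 - 2 * t / (3 - δ) := by
  have hδ₃ : 0 < 3 - δ := by linarith
  rw [one_sub_div hδ₃.ne', div_le_div_iff_of_pos_right hδ₃]
  linarith

lemma parityCorrection_nonneg (hδ : δ ≤ 1) (hb : ∀ e ∈ F, b e ≤ 1) {e : Sym2 V} (hx : 0 ≤ x e) :
    0 ≤ parityCorrection δ x b F e := by
  have hδ₃ : 0 < 3 - δ := by linarith
  have hδ₀ : 0 ≤ (1 - δ) / (3 - δ) := div_nonneg (by linarith) hδ₃.le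
  unfold parityCorrection
  split_ifs with he
  · have := hδ₀.trans (le_one_sub_two_mul_div hδ (hb e he))
    positivity
  · positivity

lemma sum_parityCorrection (δ : ℝ) (x b : Sym2 V → ℝ) (F X : Finset (Sym2 V)) :
    ∑ e ∈ X, parityCorrection δ x b F e =
      1 / (3 - δ) * ∑ e ∈ X, x e + ∑ e ∈ F ∩ X, (1 - 2 * b e / (3 - δ)) := by
  simp only [parityCorrection, sum_add_distrib, mul_sum, sum_ite_mem, inter_comm F]

variable [Fintype V]

lemma cost_parityCorrection (hF : F ⊆ edges V) :
    cost c (parityCorrection δ x b F) =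
      1 / (3 - δ) * cost c x + ∑ e ∈ F, c e * (1 - 2 * b e / (3 - δ)) := by
  simp only [cost, parityCorrection, mul_add, sum_add_distrib, mul_ite, mul_zero, sum_ite_mem,
    inter_eq_right.2 hF, mul_sum, mul_left_comm]

lemma one_le_sum_cut_parityCorrection (hδ : δ ≤ 1) (hb : ∀ e ∈ F, b e ≤ 1)
    (hsingle : ∀ S e, F ∩ cut S = {e} → 2 * b e ≤ ∑ f ∈ cut S, x f)
    (hcut : ∀ S, (F ∩ cut S).Nonempty → 2 * δ ≤ ∑ f ∈ cut S, x f)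
    {S : Finset V} (hS : Odd #(F ∩ cut S)) :
    1 ≤ ∑ e ∈ cut S, parityCorrection δ x b F e := by
  have hδ₃ : 0 < 3 - δ := by linarith
  rw [sum_parityCorrection]
  obtain hone | hthree : #(F ∩ cut S) = 1 ∨ 3 ≤ #(F ∩ cut S) := by
    obtain ⟨k, hk⟩ := hS
    omega
  · obtain ⟨e, he⟩ := card_eq_one.1 hone
    have hx := mul_le_mul_of_nonneg_left (hsingle S e he) (one_div_pos.2 hδ₃).le
    rw [he, sum_singleton]
    linear_combination hx
  · have hx := mul_le_mul_of_nonneg_left (hcut S (card_pos.1 (by omega))) (one_div_pos.2 hδ₃).le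
    have hF : 3 * ((1 - δ) / (3 - δ)) ≤ ∑ e ∈ F ∩ cut S, (1 - 2 * b e / (3 - δ)) :=
      calc 3 * ((1 - δ) / (3 - δ)) ≤ #(F ∩ cut S) • ((1 - δ) / (3 - δ)) := by
            rw [nsmul_eq_mul]
            have : 0 ≤ (1 - δ) / (3 - δ) := div_nonneg (by linarith) hδ₃.le
            gcongr
            exact_mod_cast hthree
        _ ≤ _ := card_nsmul_le_sum _ _ _ fun e he =>
            le_one_sub_two_mul_div hδ (hb e (mem_inter.1 he).1)
    have heq : 1 / (3 - δ) * (2 * δ) + 3 * ((1 - δ) / (3 - δ)) = 1 := by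
      field_simp
      ring
    linarith

theorem IsShortestJoin.sum_le_of_cut_bounds (hc : 0 ≤ c) (hF : F ⊆ edges V)
    (hJ : IsShortestJoin c (oddVerts F) J) (hδ : δ ≤ 1) (hx : ∀ e ∈ edges V, 0 ≤ x e)
    (hb : ∀ e ∈ F, b e ≤ 1)
    (hsingle : ∀ S e, F ∩ cut S = {e} → 2 * b e ≤ ∑ f ∈ cut S, x f)
    (hcut : ∀ S, (F ∩ cut S).Nonempty → 2 * δ ≤ ∑ f ∈ cut S, x f) :
    ∑ e ∈ J, c e ≤ 1 / (3 - δ) * cost c x + ∑ e ∈ F, c e * (1 - 2 * b e / (3 - δ)) := by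
  rw [← cost_parityCorrection hF]
  exact hJ.sum_le_cost_of_covers_cuts hc (fun e he => parityCorrection_nonneg hδ hb (hx e he))
    fun S hS => one_le_sum_cut_parityCorrection hδ hb hsingle hcut ((odd_card_inter_cut hF S).2 hS)

end ParityCorrection

section Trees

variable {V : Type*} {H T T₀ : Subgr V} {r v : V} {e : Sym2 V} {S S' : Finset V}
  {x : Sym2 V → ℝ} {y : V → ℝ} {γ : ℝ}

lemma not_connected_deleteEdges (hT : T.coe.IsTree) (he : e ∈ T.edgeSet) :
    ¬ (T.deleteEdges {e}).coe.Connected := by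
  induction e with | _ a b =>
  rw [SimpleGraph.Subgraph.coe_deleteEdges_eq]
  intro hcon
  have hab : T.coe.Adj ⟨a, T.edge_vert he⟩ ⟨b, T.edge_vert (T.adj_symm he)⟩ := he
  have hle := (SimpleGraph.isTree_iff_minimal_connected.1 hT).le_of_le hcon
    (SimpleGraph.deleteEdges_le _)
  simpa using hle hab

variable [Fintype V] [DecidableEq V]

lemma mem_subEdges : e ∈ subEdges T ↔ e ∈ T.edgeSet := by
  simp [subEdges]

lemma subEdges_mono (h : H ≤ T) : subEdges H ⊆ subEdges T := fun _ he =>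
  mem_subEdges.2 (SimpleGraph.Subgraph.edgeSet_mono h (mem_subEdges.1 he))

lemma subEdges_subset_edges (T : Subgr V) : subEdges T ⊆ edges V := by
  rintro ⟨u, v⟩ he
  exact mk_mem_edges.2 (T.adj_sub (mem_subEdges.1 he))

lemma exists_mem_verts_of_mem_cut (he : e ∈ T.edgeSet) (heS : e ∈ cut S) :
    ∃ v ∈ T.verts, v ∈ S := by
  obtain ⟨a, ha, b, -, rfl⟩ := exists_eq_mk_of_mem_cut heS
  exact ⟨a, T.edge_vert he, ha⟩

lemma coe_connected_iff_forall_cut (hr : r ∈ H.verts) :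
    H.coe.Connected ↔
      ∀ R : Finset V, r ∈ R → (∀ f ∈ H.edgeSet, f ∉ cut R) → ∀ v ∈ H.verts, v ∈ R := by
  classical
  constructor
  · intro hH R hrR hR v hv
    by_contra hvR
    obtain ⟨p⟩ := hH.preconnected ⟨r, hr⟩ ⟨v, hv⟩
    obtain ⟨d, -, hdR, hdR'⟩ := p.exists_boundary_dart {u | u.1 ∈ R} hrR hvR
    exact hR s(d.fst.1, d.snd.1) d.adj (mk_mem_cut.2 fun h => hdR' (h.1 hdR))
  · intro h
    rw [SimpleGraph.connected_iff_exists_forall_reachable]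
    let R : Finset V := {v | ∃ hv : v ∈ H.verts, H.coe.Reachable ⟨r, hr⟩ ⟨v, hv⟩}
    have hadj : ∀ {a b}, H.Adj a b → a ∈ R → b ∈ R := by
      intro a b hab ha
      simp only [R, mem_filter_univ] at ha ⊢
      obtain ⟨ha, hra⟩ := ha
      have hab' : H.coe.Adj ⟨a, ha⟩ ⟨b, H.edge_vert hab.symm⟩ := hab
      exact ⟨_, hra.trans hab'.reachable⟩
    have hR : ∀ f ∈ H.edgeSet, f ∉ cut R := by
      rintro ⟨a, b⟩ hab
      rw [mk_mem_cut, not_not]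
      exact ⟨hadj hab, hadj (H.adj_symm hab)⟩
    refine ⟨⟨r, hr⟩, fun ⟨v, hv⟩ => ?_⟩
    obtain ⟨_, hv'⟩ := mem_filter_univ v |>.1 (h R (by simp [R, hr]) hR v hv)
    exact hv'

lemma mem_iff_mem_of_cut_iff_cut (hH : H.coe.Connected) (hr : r ∈ H.verts) (hrS : r ∉ S)
    (hrS' : r ∉ S') (h : ∀ f ∈ H.edgeSet, f ∈ cut S ↔ f ∈ cut S') (hv : v ∈ H.verts) :
    v ∈ S ↔ v ∈ S' := by
  have hagree := (coe_connected_iff_forall_cut hr).1 hH {u | u ∈ S ↔ u ∈ S'} (by simp [hrS, hrS'])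
    (by
      rintro ⟨a, b⟩ hab
      have := h s(a, b) hab
      simp only [mk_mem_cut, mem_filter_univ] at this ⊢
      tauto) v hv
  simpa using hagree

/-- `δ(S)` contains no edge of `T` other than `e`, and contains `e` if this is an edge of `T`: when
`T` is a tree, `δ(S)` is the fundamental cut of `e`. -/
def IsFundamentalCut (T : Subgr V) (e : Sym2 V) (S : Finset V) : Prop :=
  ∀ f ∈ T.edgeSet, f ∈ cut S ↔ f = e

lemma IsFundamentalCut.mono (h : IsFundamentalCut T e S) (hH : H ≤ T) : IsFundamentalCut H e S :=
  fun f hf => h f (SimpleGraph.Subgraph.edgeSet_mono hH hf)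

lemma exists_isFundamentalCut (hT : T.coe.IsTree) (hr : r ∈ T.verts) (he : e ∈ T.edgeSet) :
    ∃ S : Finset V, r ∉ S ∧ IsFundamentalCut T e S := by
  have hdel := not_connected_deleteEdges hT he
  rw [coe_connected_iff_forall_cut (H := T.deleteEdges {e}) hr] at hdel
  push Not at hdel
  obtain ⟨R, hrR, hR, v, hv, hvR⟩ := hdel
  have hcut : ∀ f ∈ T.edgeSet, f ∈ cut R → f = e := by
    intro f hf hfR
    by_contra hne
    induction f with | _ a b =>
    exact hR s(a, b) (by simpa using ⟨hf, hne⟩) hfR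
  have heR : e ∈ cut R := by
    by_contra heR
    refine hvR ((coe_connected_iff_forall_cut hr).1 hT.connected R hrR (fun f hf hfR => ?_) v hv)
    exact heR (hcut f hf hfR ▸ hfR)
  refine ⟨Rᶜ, by simpa using hrR, fun f hf => ?_⟩
  rw [cut_compl]
  exact ⟨hcut f hf, fun h => h ▸ heR⟩

/-- `v` has maximum value among the vertices of the tree `T` that are separated from `r` by the
edge `e`, so that `e` belongs to the core exactly for the thresholds up to `y v`. -/
def IsPeak (r : V) (y : V → ℝ) (T : Subgr V) (e : Sym2 V) (v : V) : Prop :=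
  v ∈ T.verts ∧ ∃ S : Finset V, r ∉ S ∧ v ∈ S ∧ IsFundamentalCut T e S ∧
    ∀ u ∈ T.verts, u ∈ S → y u ≤ y v

lemma exists_isPeak (hT : T.coe.IsTree) (hr : r ∈ T.verts) (y : V → ℝ) (he : e ∈ T.edgeSet) :
    ∃ v, IsPeak r y T e v := by
  classical
  obtain ⟨S, hrS, hS⟩ := exists_isFundamentalCut hT hr he
  obtain ⟨v₀, hv₀, hv₀S⟩ := exists_mem_verts_of_mem_cut he ((hS e he).2 rfl)
  obtain ⟨v, hv, hmax⟩ := exists_max_image {v ∈ S | v ∈ T.verts} y ⟨v₀, by simp [hv₀, hv₀S]⟩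
  simp only [mem_filter] at hv hmax
  exact ⟨v, hv.2, S, hrS, hv.1, hS, fun u hu huS => hmax u ⟨huS, hu⟩⟩

/- A set `R` closed in `T - S` yields `R \ S`, which `T` leaves at most through `e`: then its
complement is the far side `S` of `e`, or it is closed in `T`. -/
lemma IsFundamentalCut.connected_deleteVerts (hS : IsFundamentalCut T e S)
    (hT : T.coe.Connected) (hr : r ∈ T.verts) (hrS : r ∉ S) :
    (T.deleteVerts (S : Set V)).coe.Connected := by
  rw [coe_connected_iff_forall_cut (r := r) (by simp [hr, hrS])]
  intro R hrR hR v hv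
  obtain ⟨hvT, hvS⟩ : v ∈ T.verts ∧ v ∉ S := by simpa using hv
  have hstep : ∀ {a b}, T.Adj a b → a ∈ R \ S → b ∉ S → b ∈ R := by
    intro a b hab ha hb
    rw [mem_sdiff] at ha
    have := hR s(a, b) (by simp [T.edge_vert hab, T.edge_vert hab.symm, hab, ha.2, hb])
    simpa [mk_mem_cut, ha.1] using this
  have hcut : ∀ f ∈ T.edgeSet, f ∈ cut (R \ S) → f = e := by
    rintro ⟨a, b⟩ hab hf
    rw [← hS _ hab, mk_mem_cut]
    have h₁ := hstep hab
    have h₂ := hstep (T.adj_symm hab)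
    rw [mk_mem_cut] at hf
    grind
  by_cases he : e ∈ cut (R \ S)
  · have hagree := mem_iff_mem_of_cut_iff_cut (S := (R \ S)ᶜ) hT hr (by simp [hrR, hrS]) hrS
      (fun f hf => by
        rw [hS f hf, cut_compl]
        exact ⟨hcut f hf, fun h => h ▸ he⟩) hvT
    simp only [mem_compl, mem_sdiff] at hagree
    tauto
  · have hclosed := (coe_connected_iff_forall_cut hr).1 hT (R \ S) (by simp [hrR, hrS])
      (fun f hf hfR => he (hcut f hf hfR ▸ hfR)) v hvT
    exact (mem_sdiff.1 hclosed).1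

lemma IsFundamentalCut.isTree_deleteVerts (hS : IsFundamentalCut T e S) (hT : T.coe.IsTree)
    (hr : r ∈ T.verts) (hrS : r ∉ S) : (T.deleteVerts (S : Set V)).coe.IsTree :=
  ⟨hS.connected_deleteVerts hT.connected hr hrS,
    hT.isAcyclic.comap (SimpleGraph.Subgraph.inclusion SimpleGraph.Subgraph.deleteVerts_le)
      (SimpleGraph.Subgraph.inclusion.injective _)⟩

/- Below a peak less than `γ` nothing has to be spanned, so the far side of `e` can be deleted. -/
lemma IsCore.le_peak (h : IsCore y T₀ γ T) (hr : r ∈ T.verts) (he : e ∈ T.edgeSet)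
    (hv : IsPeak r y T₀ e v) : γ ≤ y v := by
  by_contra! hlt
  obtain ⟨-, S, hrS, -, hS, hmax⟩ := hv
  obtain ⟨hle, htree, hspan⟩ := h.prop
  have hST := hS.mono hle
  have hspan' : ∀ u ∈ T₀.verts, γ ≤ y u → u ∈ (T.deleteVerts (S : Set V)).verts := by
    intro u hu hγu
    have huS : u ∉ S := fun huS => (hγu.trans (hmax u hu huS)).not_gt hlt
    simp [hspan u hu hγu, huS]
  have hT := h.le_of_le ⟨SimpleGraph.Subgraph.deleteVerts_le.trans hle,
    hST.isTree_deleteVerts htree hr hrS, hspan'⟩ SimpleGraph.Subgraph.deleteVerts_le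
  obtain ⟨u, hu, huS⟩ := exists_mem_verts_of_mem_cut he ((hST e he).2 rfl)
  exact (hT.1 hu).2 huS

lemma IsCore.peak_mem (h : IsCore y T₀ γ T) (hr : r ∈ T.verts) (he : e ∈ T.edgeSet)
    (hv : IsPeak r y T₀ e v) (hrS : r ∉ S) (hS : IsFundamentalCut T e S) : v ∈ S := by
  have hγv := h.le_peak hr he hv
  obtain ⟨hvT₀, S', hrS', hvS', hS', -⟩ := hv
  obtain ⟨hle, htree, hspan⟩ := h.prop
  exact (mem_iff_mem_of_cut_iff_cut htree.connected hr hrS hrS'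
    (fun f hf => (hS f hf).trans (hS'.mono hle f hf).symm) (hspan v hvT₀ hγv)).2 hvS'

lemma IsCore.two_mul_peak_le_sum_cut (h : IsCore y T₀ γ T) (hr : r ∈ T.verts)
    (hcuts : ∀ S : Finset V, r ∉ S → ∀ v ∈ S, 2 * y v ≤ ∑ e ∈ cut S, x e)
    (hv : IsPeak r y T₀ e v) (hS : subEdges T ∩ cut S = {e}) : 2 * y v ≤ ∑ f ∈ cut S, x f := by
  wlog hrS : r ∉ S generalizing S
  · rw [← cut_compl] at hS ⊢
    exact this hS (by simpa using hrS)
  have he : e ∈ subEdges T ∩ cut S := hS ▸ mem_singleton_self e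
  have hfund : IsFundamentalCut T e S := fun f hf => by
    rw [← mem_singleton, ← hS, mem_inter, mem_subEdges, and_iff_right hf]
  exact hcuts S hrS v (h.peak_mem hr (mem_subEdges.1 (mem_inter.1 he).1) hv hrS hfund)

lemma two_mul_le_sum_cut_of_nonempty {δ : ℝ}
    (hcuts : ∀ S : Finset V, r ∉ S → ∀ v ∈ S, 2 * y v ≤ ∑ e ∈ cut S, x e)
    (hδ : ∀ v ∈ T.verts, δ ≤ y v) (hS : (subEdges T ∩ cut S).Nonempty) :
    2 * δ ≤ ∑ f ∈ cut S, x f := by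
  wlog hrS : r ∉ S generalizing S
  · rw [← cut_compl] at hS ⊢
    exact this hS (by simpa using hrS)
  obtain ⟨e, he⟩ := hS
  obtain ⟨heT, heS⟩ := mem_inter.1 he
  obtain ⟨v, hv, hvS⟩ := exists_mem_verts_of_mem_cut (mem_subEdges.1 heT) heS
  linarith [hcuts S hrS v hvS, hδ v hv]

end Trees

section Shortcut

variable {V : Type*} {c : Sym2 V → ℝ} {l l' : List V}

/-- Length of the walk that starts at `a`, visits the vertices of the list in this order and ends
at `b`. Unlike in `cycleLength`, the end points are free, which makes it amenable to induction. -/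
def walkLength (c : Sym2 V → ℝ) : V → List V → V → ℝ
  | a, [], b => c s(a, b)
  | a, v :: l, b => c s(a, v) + walkLength c v l b

lemma sum_zipWith_cons_append_singleton (a : V) (l : List V) (b : V) :
    (List.zipWith (fun u v => c s(u, v)) (a :: l) (l ++ [b])).sum = walkLength c a l b := by
  induction l generalizing a with
  | nil => simp [walkLength]
  | cons v l ih => simpa [walkLength] using ih v

lemma cycleLength_cons (a : V) (l : List V) : cycleLength c (a :: l) = walkLength c a l a := by
  simpa [cycleLength] using sum_zipWith_cons_append_singleton a l a

lemma le_walkLength (hc : IsMetric c) (a b : V) (l : List V) : c s(a, b) ≤ walkLength c a l b := by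
  induction l generalizing a with
  | nil => exact le_rfl
  | cons u l ih => exact (hc.triangle a u b).trans (add_le_add_right (ih u) _)

lemma walkLength_le_add_walkLength (hc : IsMetric c) (a v b : V) (l : List V) :
    walkLength c a l b ≤ c s(a, v) + walkLength c v l b := by
  cases l with
  | nil => exact hc.triangle a v b
  | cons u l =>
    simp only [walkLength]
    linarith [hc.triangle a v u]

lemma walkLength_le_walkLength_add (hc : IsMetric c) (a v b : V) (l : List V) :
    walkLength c a l b ≤ walkLength c a l v + c s(v, b) := by
  induction l generalizing a with
  | nil => exact hc.triangle a v b
  | cons u l ih =>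
    simp only [walkLength]
    linarith [ih u]

lemma walkLength_le_of_sublist (hc : IsMetric c) (h : l'.Sublist l) (a b : V) :
    walkLength c a l' b ≤ walkLength c a l b := by
  induction h generalizing a with
  | slnil => exact le_rfl
  | cons v _ ih => exact (walkLength_le_add_walkLength hc a v b _).trans (add_le_add_right (ih v) _)
  | cons_cons v _ ih => exact add_le_add_right (ih v) _

lemma cycleLength_nonneg (hc : IsMetric c) (C : List V) : 0 ≤ cycleLength c C := by
  cases C with
  | nil => exact le_rfl
  | cons a l => exact cycleLength_cons (c := c) a l ▸ (hc.nonneg _).trans (le_walkLength hc a a l)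

lemma cycleLength_le_cycleLength_cons (hc : IsMetric c) (a : V) (l : List V) :
    cycleLength c l ≤ cycleLength c (a :: l) := by
  cases l with
  | nil => exact cycleLength_nonneg hc [a]
  | cons b l =>
    rw [cycleLength_cons, cycleLength_cons, walkLength]
    linarith [walkLength_le_walkLength_add hc b a b l]

lemma cycleLength_le_of_sublist (hc : IsMetric c) (h : l'.Sublist l) :
    cycleLength c l' ≤ cycleLength c l := by
  induction h with
  | slnil => exact le_rfl
  | cons a _ ih => exact ih.trans (cycleLength_le_cycleLength_cons hc a _)
  | cons_cons v h _ =>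
    rw [cycleLength_cons, cycleLength_cons]
    exact walkLength_le_of_sublist hc h v v

lemma walkLength_tail_support (hc : IsMetric c) {a b : V} (w : (⊤ : SimpleGraph V).Walk a b) :
    walkLength c a w.support.tail b = (w.edges.map c).sum := by
  induction w with
  | nil => simp [walkLength, hc.self]
  | cons h p ih =>
    rw [SimpleGraph.Walk.support_cons, List.tail_cons, ← SimpleGraph.Walk.cons_tail_support,
      walkLength, ih, SimpleGraph.Walk.edges_cons, List.map_cons, List.sum_cons]

lemma cycleLength_support (hc : IsMetric c) {u : V} (w : (⊤ : SimpleGraph V).Walk u u) :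
    cycleLength c w.support = (w.edges.map c).sum := by
  rw [← SimpleGraph.Walk.cons_tail_support, cycleLength_cons, walkLength_tail_support hc]

lemma IsCorrectedCycle.exists_isShortestJoin [Fintype V] [DecidableEq V] (hc : IsMetric c)
    {T : Subgr V} {C : List V} (h : IsCorrectedCycle c T C) :
    ∃ J, IsShortestJoin c (oddVerts (subEdges T)) J ∧
      cycleLength c C ≤ ∑ e ∈ subEdges T, c e + ∑ e ∈ J, c e := by
  obtain ⟨J, u, w, hJ, hw, -, hC, -, -⟩ := h
  have hsum : (w.edges.map c).sum = ∑ e ∈ subEdges T, c e + ∑ e ∈ J, c e := by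
    simpa using congrArg (fun m => (Multiset.map c m).sum) hw
  exact ⟨J, hJ, (cycleLength_le_of_sublist hc hC).trans_eq ((cycleLength_support hc w).trans hsum)⟩

end Shortcut

section Splitting

variable {V : Type*} [Fintype V] [DecidableEq V] {r u v : V} {c : Sym2 V → ℝ} {δ : ℝ} {l : List V}
  {p q : (Sym2 V → ℝ) × (V → ℝ)} {x x' : Sym2 V → ℝ} {y y' : V → ℝ}

lemma cost_add (x x' : Sym2 V → ℝ) : cost c (x + x') = cost c x + cost c x' := by
  simp [cost, mul_add, sum_add_distrib]

lemma cost_sub (x x' : Sym2 V → ℝ) : cost c (x - x') = cost c x - cost c x' := by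
  simp [cost, mul_sub, sum_sub_distrib]

lemma cost_single (hc : IsMetric c) (e : Sym2 V) (ε : ℝ) : cost c (Pi.single e ε) = c e * ε := by
  unfold cost
  by_cases he : e ∈ edges V
  · rw [sum_eq_single_of_mem e he fun f _ hf => by rw [Pi.single_eq_of_ne hf, mul_zero],
      Pi.single_eq_same]
  · have hloop : c e = 0 := by
      induction e with | _ u v =>
      obtain rfl : u = v := by simpa [edges] using he
      exact hc.self u
    rw [hloop, zero_mul]
    refine sum_eq_zero fun f hf => ?_
    rw [Pi.single_eq_of_ne (ne_of_mem_of_not_mem hf he), mul_zero]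

lemma FeasibleSplitting.feasible (h : FeasibleSplitting r v p q) : Feasible r q.1 q.2 := by
  obtain ⟨-, -, -, -, -, -, -, -, hq⟩ := h
  exact hq

lemma FeasibleSplitting.snd_of_ne (h : FeasibleSplitting r v p q) (hu : u ≠ v) :
    q.2 u = p.2 u := by
  obtain ⟨-, -, ε, -, -, -, -, hy, -⟩ := h
  rw [hy, Pi.sub_apply, Pi.single_eq_of_ne hu, sub_zero]

lemma FeasibleSplitting.cost_le (hc : IsMetric c) (h : FeasibleSplitting r v p q) :
    cost c q.1 ≤ cost c p.1 := by
  obtain ⟨s, t, ε, -, -, hε, hx, -, -⟩ := h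
  have htri : c s(s, t) * ε ≤ (c s(v, s) + c s(v, t)) * ε :=
    mul_le_mul_of_nonneg_right (Sym2.eq_swap (a := s) (b := v) ▸ hc.triangle s v t) hε
  rw [hx, cost_add, cost_sub, cost_sub, cost_single hc, cost_single hc, cost_single hc]
  linarith

lemma CompleteSplitting.feasible (h : CompleteSplitting r v p q) (hp : Feasible r p.1 p.2) :
    Feasible r q.1 q.2 := by
  obtain ⟨h, -⟩ := h
  cases h with
  | refl => exact hp
  | tail _ h => exact h.feasible

lemma CompleteSplitting.snd_of_ne (h : CompleteSplitting r v p q) (hu : u ≠ v) :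
    q.2 u = p.2 u := by
  obtain ⟨h, -⟩ := h
  induction h with
  | refl => rfl
  | tail _ h ih => exact (h.snd_of_ne hu).trans ih

lemma CompleteSplitting.cost_le (hc : IsMetric c) (h : CompleteSplitting r v p q) :
    cost c q.1 ≤ cost c p.1 := by
  obtain ⟨h, -⟩ := h
  induction h with
  | refl => exact le_rfl
  | tail _ h ih => exact (h.cost_le hc).trans ih

lemma CompleteSplittings.feasible (h : CompleteSplittings r l p q) (hp : Feasible r p.1 p.2) :
    Feasible r q.1 q.2 := by
  induction h with
  | nil => exact hp
  | cons h _ ih => exact ih (h.feasible hp)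

lemma CompleteSplittings.cost_le (hc : IsMetric c) (h : CompleteSplittings r l p q) :
    cost c q.1 ≤ cost c p.1 := by
  induction h with
  | nil => exact le_rfl
  | cons h _ ih => exact ih.trans (h.cost_le hc)

lemma CompleteSplittings.snd_of_notMem (h : CompleteSplittings r l p q) (hu : u ∉ l) :
    q.2 u = p.2 u := by
  induction h with
  | nil => rfl
  | cons h _ ih =>
    exact (ih (List.not_mem_of_not_mem_cons hu)).trans (h.snd_of_ne (List.ne_of_not_mem_cons hu))

lemma CompleteSplittings.snd_eq_zero (h : CompleteSplittings r l p q) (hu : u ∈ l) :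
    q.2 u = 0 := by
  induction h with
  | nil => simp at hu
  | @cons v l p q q' h hs ih =>
    by_cases hul : u ∈ l
    · exact ih hul
    · obtain rfl := (List.mem_cons.1 hu).resolve_right hul
      exact (hs.snd_of_notMem hul).trans h.2

lemma ObtainedBySplitting.feasible (h : ObtainedBySplitting r δ x' y' x y)
    (hs : Feasible r x' y') : Feasible r x y :=
  let ⟨_, _, _, hl⟩ := h
  hl.feasible hs

lemma ObtainedBySplitting.cost_le (hc : IsMetric c) (h : ObtainedBySplitting r δ x' y' x y) :
    cost c x ≤ cost c x' :=
  let ⟨_, _, _, hl⟩ := h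
  hl.cost_le hc

lemma ObtainedBySplitting.eq_zero_or_le (h : ObtainedBySplitting r δ x' y' x y) (v : V) :
    y v = 0 ∨ δ ≤ y v := by
  obtain ⟨l, -, hmem, hl⟩ := h
  by_cases hv : v ∈ l
  · exact Or.inl (hl.snd_eq_zero hv)
  · exact Or.inr ((not_lt.1 fun hlt => hv ((hmem v).2 hlt)).trans_eq (hl.snd_of_notMem hv).symm)

end Splitting

section Conditioning

variable {Ω α β : Type*} {X : Ω → α} {Y : Ω → β} {s : Finset α} {g : α → β → ℝ} {a : α}
  [MeasurableSpace Ω] {P : Measure Ω}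

lemma comp_ae_eq_sum_indicator (hs : ∀ᵐ ω ∂P, X ω ∈ s) (g : α → β → ℝ) :
    (fun ω => g (X ω) (Y ω)) =ᵐ[P]
      fun ω => ∑ a ∈ s, (X ⁻¹' {a}).indicator (fun ω => g a (Y ω)) ω := by
  filter_upwards [hs] with ω hω
  rw [sum_eq_single_of_mem (X ω) hω fun a _ ha => by simp [ha.symm]]
  simp

variable [MeasurableSpace α] [MeasurableSingletonClass α]

lemma ae_mem_of_sum_measureReal_eq_one [IsProbabilityMeasure P] (hX : Measurable X)
    (hs : ∑ a ∈ s, P.real {ω | X ω = a} = 1) : ∀ᵐ ω ∂P, X ω ∈ s := by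
  have hpre : P.real (X ⁻¹' s) = 1 :=
    (sum_measureReal_preimage_singleton s fun a _ => hX (measurableSet_singleton a)).symm.trans hs
  rw [measureReal_def, ENNReal.toReal_eq_one_iff] at hpre
  exact (mem_ae_iff_prob_eq_one (hX s.measurableSet)).2 hpre

lemma integrable_comp_of_ae_mem (hX : Measurable X) (hs : ∀ᵐ ω ∂P, X ω ∈ s)
    (hg : ∀ a ∈ s, Integrable (fun ω => g a (Y ω)) P) :
    Integrable (fun ω => g (X ω) (Y ω)) P :=
  (integrable_finsetSum _ fun a ha => (hg a ha).indicator (hX (measurableSet_singleton a))).congr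
    (comp_ae_eq_sum_indicator hs g).symm

variable [MeasurableSpace β]

lemma integral_indicator_comp_of_indepFun (hX : Measurable X) (hY : Measurable Y)
    (hXY : ProbabilityTheory.IndepFun X Y P) {f : β → ℝ} (hf : Measurable f) :
    ∫ ω, (X ⁻¹' {a}).indicator (fun ω => f (Y ω)) ω ∂P =
      P.real {ω | X ω = a} * ∫ ω, f (Y ω) ∂P := by
  have ha : Measurable (Set.indicator {a} (1 : α → ℝ)) :=
    measurable_one.indicator (measurableSet_singleton a)
  have hmul := (hXY.comp ha hf).integral_mul_eq_mul_integral
    (ha.comp hX).aestronglyMeasurable (hf.comp hY).aestronglyMeasurable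
  have hone : ∫ ω, Set.indicator {a} (1 : α → ℝ) (X ω) ∂P = P.real {ω | X ω = a} :=
    integral_indicator_one (hX (measurableSet_singleton a))
  simp only [Function.comp_def, Pi.mul_def, hone] at hmul
  rw [← hmul]
  congr with ω
  by_cases hω : X ω = a <;> simp [hω]

lemma integral_comp_of_indepFun (hX : Measurable X) (hY : Measurable Y)
    (hXY : ProbabilityTheory.IndepFun X Y P) (hs : ∀ᵐ ω ∂P, X ω ∈ s)
    (hg : ∀ a ∈ s, Measurable (g a)) (hgi : ∀ a ∈ s, Integrable (fun ω => g a (Y ω)) P) :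
    ∫ ω, g (X ω) (Y ω) ∂P = ∑ a ∈ s, P.real {ω | X ω = a} * ∫ ω, g a (Y ω) ∂P := by
  rw [integral_congr_ae (comp_ae_eq_sum_indicator hs g), integral_finsetSum _ fun a ha =>
    (hgi a ha).indicator (hX (measurableSet_singleton a))]
  exact sum_congr rfl fun a ha => integral_indicator_comp_of_indepFun hX hY hXY (hg a ha)

end Conditioning

section CoreBound

variable {V : Type*} [Fintype V] [DecidableEq V] {c x b : Sym2 V → ℝ} {y : V → ℝ} {r : V}
  {T T₀ : Subgr V} {C : List V} {δ κ t p : ℝ} {Ω : Type*} [MeasurableSpace Ω] {P : Measure Ω}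
  {γ : Ω → ℝ}

/-- Total price of the edges of `T` whose peak value `b e` reaches the threshold `t`. The price
`c e (2 - 2 b e / (3 - δ))` of `e` is its own length together with what `parityCorrection` charges
to it. -/
noncomputable def coreBound (c : Sym2 V → ℝ) (δ : ℝ) (b : Sym2 V → ℝ) (T : Subgr V) (t : ℝ) : ℝ :=
  ∑ e ∈ subEdges T with t ≤ b e, c e * (2 - 2 * b e / (3 - δ))

lemma IsCorrectedCycle.cycleLength_le (hc : IsMetric c) (hδ : δ ≤ 1)
    (hx : ∀ e ∈ edges V, 0 ≤ x e) (hy : ∀ v, y v ≤ 1)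
    (hcut : ∀ S : Finset V, r ∉ S → ∀ v ∈ S, 2 * y v ≤ ∑ e ∈ cut S, x e)
    (hδy : ∀ v ∈ T₀.verts, δ ≤ y v) {peak : Sym2 V → V}
    (hpeak : ∀ e ∈ T₀.edgeSet, IsPeak r y T₀ e (peak e)) (hT : IsCore y T₀ t T)
    (hr : r ∈ T.verts) (hC : IsCorrectedCycle c T C) :
    cycleLength c C ≤ 1 / (3 - δ) * cost c x + coreBound c δ (fun e => y (peak e)) T₀ t := by
  obtain ⟨J, hJ, hlen⟩ := hC.exists_isShortestJoin hc
  have hle : T ≤ T₀ := hT.prop.1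
  have hpeak' : ∀ e ∈ T.edgeSet, IsPeak r y T₀ e (peak e) := fun e he =>
    hpeak e (SimpleGraph.Subgraph.edgeSet_mono hle he)
  have hjoin := hJ.sum_le_of_cut_bounds (b := fun e => y (peak e)) hc.nonneg
    (subEdges_subset_edges T) hδ hx (fun e _ => hy _)
    (fun S e hS => hT.two_mul_peak_le_sum_cut hr hcut
      (hpeak' e (mem_subEdges.1 (inter_subset_left (hS ▸ mem_singleton_self e)))) hS)
    (fun S => two_mul_le_sum_cut_of_nonempty hcut fun v hv => hδy v (hle.1 hv))
  have hcore : subEdges T ⊆ {e ∈ subEdges T₀ | t ≤ y (peak e)} := fun e he => mem_filter.2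
    ⟨subEdges_mono hle he, hT.le_peak hr (mem_subEdges.1 he) (hpeak' e (mem_subEdges.1 he))⟩
  have hprice : ∀ e, 0 ≤ c e * (2 - 2 * y (peak e) / (3 - δ)) := fun e =>
    mul_nonneg (hc.nonneg e)
      (sub_nonneg.2 ((div_le_iff₀ (by linarith)).2 (by linarith [hy (peak e)])))
  calc cycleLength c C
      ≤ 1 / (3 - δ) * cost c x + ∑ e ∈ subEdges T, c e * (2 - 2 * y (peak e) / (3 - δ)) := by
        have hsplit : ∑ e ∈ subEdges T, c e * (2 - 2 * y (peak e) / (3 - δ)) =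
            ∑ e ∈ subEdges T, c e + ∑ e ∈ subEdges T, c e * (1 - 2 * y (peak e) / (3 - δ)) := by
          rw [← sum_add_distrib]
          exact sum_congr rfl fun e _ => by ring
        linarith
    _ ≤ 1 / (3 - δ) * cost c x + coreBound c δ (fun e => y (peak e)) T₀ t :=
        add_le_add_right (sum_le_sum_of_subset_of_nonneg hcore fun e _ _ => hprice e) _

lemma coreBound_eq_sum_indicator (c : Sym2 V → ℝ) (δ : ℝ) (b : Sym2 V → ℝ) (T : Subgr V) :
    coreBound c δ b T = fun t =>
      ∑ e ∈ subEdges T, (Set.Iic (b e)).indicator (fun _ => c e * (2 - 2 * b e / (3 - δ))) t := by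
  ext t
  simp only [coreBound, sum_filter, Set.indicator_apply, Set.mem_Iic]

lemma measurable_coreBound (c : Sym2 V → ℝ) (δ : ℝ) (b : Sym2 V → ℝ) (T : Subgr V) :
    Measurable (coreBound c δ b T) := by
  rw [coreBound_eq_sum_indicator]
  exact Finset.measurable_fun_sum _ fun e _ => measurable_const.indicator measurableSet_Iic

lemma integrable_indicator_Iic_comp [IsFiniteMeasure P] (hγ : Measurable γ) (s w : ℝ) :
    Integrable (fun ω => (Set.Iic s).indicator (fun _ => w) (γ ω)) P :=
  (integrable_const w).indicator (hγ measurableSet_Iic)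

lemma integrable_coreBound [IsFiniteMeasure P] (hγ : Measurable γ) (c : Sym2 V → ℝ) (δ : ℝ)
    (b : Sym2 V → ℝ) (T : Subgr V) : Integrable (fun ω => coreBound c δ b T (γ ω)) P := by
  rw [coreBound_eq_sum_indicator]
  exact integrable_finsetSum _ fun e _ => integrable_indicator_Iic_comp hγ _ _

lemma integral_coreBound [IsFiniteMeasure P] (hγ : Measurable γ) (c : Sym2 V → ℝ) (δ : ℝ)
    (b : Sym2 V → ℝ) (T : Subgr V) :
    ∫ ω, coreBound c δ b T (γ ω) ∂P =
      ∑ e ∈ subEdges T, P.real {ω | γ ω ≤ b e} * (c e * (2 - 2 * b e / (3 - δ))) := by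
  rw [coreBound_eq_sum_indicator, integral_finsetSum _ fun e _ =>
    integrable_indicator_Iic_comp hγ _ _]
  exact sum_congr rfl fun e _ => integral_indicator_const _ (hγ measurableSet_Iic)

lemma core_prob_mul_le (hδ : δ ≤ 1) (hδt : δ ≤ t) (ht : t ≤ 1) (hp₁ : p ≤ 1)
    (hp : t ∈ Set.Icc δ κ → p ≤ (3 - δ - κ) / (3 - δ - t)) :
    p * (2 - 2 * t / (3 - δ)) ≤ 2 * (3 - δ - κ) / (3 - δ) := by
  have hδ₃ : 0 < 3 - δ := by linarith
  have ht₃ : 0 < 3 - δ - t := by linarith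
  rw [show 2 - 2 * t / (3 - δ) = 2 * (3 - δ - t) / (3 - δ) by field_simp, ← mul_div_assoc,
    div_le_div_iff_of_pos_right hδ₃]
  obtain htκ | htκ := le_or_gt t κ
  · linarith [(le_div_iff₀ ht₃).1 (hp ⟨hδt, htκ⟩)]
  · linarith [mul_le_of_le_one_left ht₃.le hp₁]

lemma integral_coreBound_le [IsProbabilityMeasure P] (hc : 0 ≤ c) (hδ : δ ≤ 1)
    (hγ : Measurable γ)
    (hγ_cdf : ∀ t ∈ Set.Icc δ κ, P.real {ω | γ ω ≤ t} ≤ (3 - δ - κ) / (3 - δ - t))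
    (hb : ∀ e ∈ subEdges T, δ ≤ b e ∧ b e ≤ 1) :
    ∫ ω, coreBound c δ b T (γ ω) ∂P ≤ 2 * (3 - δ - κ) / (3 - δ) * ∑ e ∈ subEdges T, c e := by
  rw [integral_coreBound hγ, mul_sum]
  refine sum_le_sum fun e he => ?_
  rw [mul_left_comm, mul_comm _ (c e)]
  exact mul_le_mul_of_nonneg_left
    (core_prob_mul_le hδ (hb e he).1 (hb e he).2 measureReal_le_one (hγ_cdf (b e))) (hc e)

end CoreBound

section Decomposition

instance instDiscreteMeasurableSpaceSubgr (V : Type*) : DiscreteMeasurableSpace (Subgr V) :=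
  ⟨fun _ => trivial⟩

variable {V : Type*} [Fintype V] [DecidableEq V] {c x : Sym2 V → ℝ} {y : V → ℝ} {r v : V}
  {T : Subgr V} {𝒯 : Finset (Subgr V)} {μ : Subgr V → ℝ} {δ κ : ℝ}

namespace IsTreeDecomposition

lemma y_le_one (h : IsTreeDecomposition r x y 𝒯 μ) (v : V) : y v ≤ 1 := by
  classical
  rw [← h.vert_eq v, ← h.sum_eq_one]
  exact sum_le_sum_of_subset_of_nonneg (filter_subset _ _) fun T hT _ => (h.mem_Icc T hT).1

lemma y_root (h : IsTreeDecomposition r x y 𝒯 μ) : y r = 1 := by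
  classical
  rw [← h.vert_eq r, filter_true_of_mem h.root_mem, h.sum_eq_one]

lemma nonneg_x (h : IsTreeDecomposition r x y 𝒯 μ) {e : Sym2 V} (he : e ∈ edges V) : 0 ≤ x e := by
  classical
  exact (sum_nonneg fun T hT => (h.mem_Icc T (mem_filter.1 hT).1).1).trans (h.edge_le e he)

lemma weight_le_y (h : IsTreeDecomposition r x y 𝒯 μ) (hT : T ∈ 𝒯) (hv : v ∈ T.verts) :
    μ T ≤ y v := by
  classical
  rw [← h.vert_eq v]
  exact single_le_sum (f := μ) (fun T hT => (h.mem_Icc T (mem_filter.1 hT).1).1)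
    (mem_filter.2 ⟨hT, hv⟩)

lemma le_y_of_mem_verts (h : IsTreeDecomposition r x y 𝒯 μ) (hy : ∀ v, y v = 0 ∨ δ ≤ y v)
    (hT : T ∈ 𝒯) (hμT : 0 < μ T) (hv : v ∈ T.verts) : δ ≤ y v :=
  (hy v).resolve_left (hμT.trans_le (h.weight_le_y hT hv)).ne'

lemma sum_weight_mul_cost_le (h : IsTreeDecomposition r x y 𝒯 μ) (hc : 0 ≤ c) :
    ∑ T ∈ 𝒯, μ T * ∑ e ∈ subEdges T, c e ≤ cost c x := by
  classical
  have hfilter (T : Subgr V) : subEdges T = {e ∈ edges V | e ∈ T.edgeSet} := by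
    ext e
    rw [mem_filter, ← mem_subEdges, ← mem_inter, inter_eq_right.2 (subEdges_subset_edges T)]
  calc ∑ T ∈ 𝒯, μ T * ∑ e ∈ subEdges T, c e
      = ∑ e ∈ edges V, c e * ∑ T ∈ 𝒯 with e ∈ T.edgeSet, μ T := by
        simp only [hfilter, mul_sum, sum_filter]
        rw [sum_comm]
        exact sum_congr rfl fun e _ => sum_congr rfl fun T _ => by
          simp only [mul_ite, mul_zero, mul_comm]
    _ ≤ cost c x := sum_le_sum fun e he => mul_le_mul_of_nonneg_left (h.edge_le e he) (hc e)

lemma exists_forall_isPeak (h : IsTreeDecomposition r x y 𝒯 μ) :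
    ∃ peak : Subgr V → Sym2 V → V,
      ∀ T ∈ 𝒯, ∀ e ∈ T.edgeSet, IsPeak r y T e (peak T e) := by
  have hpeak (T : Subgr V) (e : Sym2 V) : ∃ v, T ∈ 𝒯 → e ∈ T.edgeSet → IsPeak r y T e v := by
    by_cases hTe : T ∈ 𝒯 ∧ e ∈ T.edgeSet
    · obtain ⟨v, hv⟩ := exists_isPeak (h.isTree T hTe.1) (h.root_mem T hTe.1) y hTe.2
      exact ⟨v, fun _ _ => hv⟩
    · exact ⟨r, fun hT he => absurd ⟨hT, he⟩ hTe⟩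
  choose peak hpeak using hpeak
  exact ⟨peak, fun T hT e he => hpeak T e hT he⟩

variable {Ω : Type*} [MeasurableSpace Ω] {P : Measure Ω} [IsProbabilityMeasure P]
  {T₀ : Ω → Subgr V} {γ : Ω → ℝ}

lemma ae_mem_and_pos (h : IsTreeDecomposition r x y 𝒯 μ) (hT₀ : Measurable T₀)
    (hT₀_law : ∀ T ∈ 𝒯, P.real {ω | T₀ ω = T} = μ T) :
    ∀ᵐ ω ∂P, T₀ ω ∈ 𝒯 ∧ 0 < μ (T₀ ω) := by
  have hsum : ∑ T ∈ 𝒯 with 0 < μ T, P.real {ω | T₀ ω = T} = 1 := by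
    rw [sum_congr rfl fun T hT => hT₀_law T (mem_filter.1 hT).1, ← h.sum_eq_one]
    exact sum_filter_of_ne fun T hT hne => (h.mem_Icc T hT).1.lt_of_ne' hne
  filter_upwards [ae_mem_of_sum_measureReal_eq_one hT₀ hsum] with ω hω
  exact mem_filter.1 hω

lemma integral_coreBound_le (h : IsTreeDecomposition r x y 𝒯 μ) (hc : 0 ≤ c) (hδ : δ ≤ 1)
    (hκ : κ ≤ 1) (hT₀ : Measurable T₀) (hT₀_law : ∀ T ∈ 𝒯, P.real {ω | T₀ ω = T} = μ T)
    (hγ : Measurable γ)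
    (hγ_cdf : ∀ t ∈ Set.Icc δ κ, P.real {ω | γ ω ≤ t} ≤ (3 - δ - κ) / (3 - δ - t))
    (hind : ProbabilityTheory.IndepFun T₀ γ P) {b : Subgr V → Sym2 V → ℝ}
    (hb : ∀ T ∈ 𝒯, 0 < μ T → ∀ e ∈ subEdges T, δ ≤ b T e ∧ b T e ≤ 1) :
    ∫ ω, coreBound c δ (b (T₀ ω)) (T₀ ω) (γ ω) ∂P ≤ 2 * (3 - δ - κ) / (3 - δ) * cost c x := by
  have hfactor : 0 ≤ 2 * (3 - δ - κ) / (3 - δ) := div_nonneg (by linarith) (by linarith)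
  calc ∫ ω, coreBound c δ (b (T₀ ω)) (T₀ ω) (γ ω) ∂P
      = ∑ T ∈ 𝒯, μ T * ∫ ω, coreBound c δ (b T) T (γ ω) ∂P := by
        rw [integral_comp_of_indepFun (g := fun T => coreBound c δ (b T) T) hT₀ hγ hind
          ((h.ae_mem_and_pos hT₀ hT₀_law).mono fun _ hω => hω.1)
          (fun T _ => measurable_coreBound _ _ _ T) fun T _ => integrable_coreBound hγ _ _ _ T]
        exact sum_congr rfl fun T hT => by rw [hT₀_law T hT]
    _ ≤ ∑ T ∈ 𝒯, μ T * (2 * (3 - δ - κ) / (3 - δ) * ∑ e ∈ subEdges T, c e) := by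
        refine sum_le_sum fun T hT => ?_
        obtain hμT | hμT := (h.mem_Icc T hT).1.eq_or_lt
        · simp [← hμT]
        · exact mul_le_mul_of_nonneg_left
            (PCTSP.integral_coreBound_le hc hδ hγ hγ_cdf (hb T hT hμT)) hμT.le
    _ = 2 * (3 - δ - κ) / (3 - δ) * ∑ T ∈ 𝒯, μ T * ∑ e ∈ subEdges T, c e := by
        rw [mul_sum]
        exact sum_congr rfl fun T _ => mul_left_comm _ _ _
    _ ≤ 2 * (3 - δ - κ) / (3 - δ) * cost c x :=
        mul_le_mul_of_nonneg_left (h.sum_weight_mul_cost_le hc) hfactor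

end IsTreeDecomposition

end Decomposition

end PCTSP

open Finset MeasureTheory in
theorem lemma4_general {V : Type*} [Fintype V] [DecidableEq V] (r : V)
    (c : Sym2 V → ℝ) (hc : PCTSP.IsMetric c) (δ κ : ℝ) (hδ₁ : δ ≤ 1) (hκ₁ : κ ≤ 1)
    (x : Sym2 V → ℝ) (y : V → ℝ)
    (hcut : ∀ S : Finset V, r ∉ S → ∀ v ∈ S, 2 * y v ≤ ∑ e ∈ PCTSP.cut S, x e)
    (hy : ∀ v, y v = 0 ∨ δ ≤ y v)
    (𝒯 : Finset (PCTSP.Subgr V)) (μ : PCTSP.Subgr V → ℝ)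
    (hμ : PCTSP.IsTreeDecomposition r x y 𝒯 μ)
    {Ω : Type*} [MeasurableSpace Ω] (P : Measure Ω) [IsProbabilityMeasure P]
    (T₀ : Ω → PCTSP.Subgr V) (hT₀ : Measurable T₀)
    (hT₀_law : ∀ T ∈ 𝒯, P.real {ω | T₀ ω = T} = μ T)
    (γ : Ω → ℝ) (hγ : Measurable γ) (hγ_le : ∀ᵐ ω ∂P, γ ω ≤ 1)
    (hγ_cdf : ∀ t ∈ Set.Icc δ κ, P.real {ω | γ ω ≤ t} ≤ (3 - δ - κ) / (3 - δ - t))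
    (hind : ProbabilityTheory.IndepFun T₀ γ P)
    (T : Ω → PCTSP.Subgr V) (hT : ∀ᵐ ω ∂P, PCTSP.IsCore y (T₀ ω) (γ ω) (T ω))
    (C : Ω → List V) (hC : ∀ᵐ ω ∂P, PCTSP.IsCorrectedCycle c (T ω) (C ω))
    (hC_meas : AEMeasurable (fun ω => PCTSP.cycleLength c (C ω)) P) :
    Integrable (fun ω => PCTSP.cycleLength c (C ω)) P ∧
      ∫ ω, PCTSP.cycleLength c (C ω) ∂P ≤ (7 - 2 * δ - 2 * κ) / (3 - δ) * PCTSP.cost c x := by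
  obtain ⟨peak, hpeak⟩ := hμ.exists_forall_isPeak
  let b : PCTSP.Subgr V → Sym2 V → ℝ := fun S e => y (peak S e)
  have hae := hμ.ae_mem_and_pos hT₀ hT₀_law
  have hbound : ∀ᵐ ω ∂P, PCTSP.cycleLength c (C ω) ≤
      1 / (3 - δ) * PCTSP.cost c x + PCTSP.coreBound c δ (b (T₀ ω)) (T₀ ω) (γ ω) := by
    filter_upwards [hae, hγ_le, hT, hC] with ω ⟨hω, hpos⟩ hγω hTω hCω
    have hr : r ∈ (T ω).verts := hTω.prop.2.2 r (hμ.root_mem _ hω) (hμ.y_root ▸ hγω)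
    exact hCω.cycleLength_le hc hδ₁ (fun _ => hμ.nonneg_x) hμ.y_le_one hcut
      (fun _ => hμ.le_y_of_mem_verts hy hω hpos) (hpeak _ hω) hTω hr
  have hcore : Integrable (fun ω => PCTSP.coreBound c δ (b (T₀ ω)) (T₀ ω) (γ ω)) P :=
    PCTSP.integrable_comp_of_ae_mem (g := fun S => PCTSP.coreBound c δ (b S) S) hT₀
      (hae.mono fun _ hω => hω.1) fun S _ => PCTSP.integrable_coreBound hγ _ _ _ S
  have hbound_int : Integrable (fun ω => 1 / (3 - δ) * PCTSP.cost c x +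
      PCTSP.coreBound c δ (b (T₀ ω)) (T₀ ω) (γ ω)) P := (integrable_const _).add hcore
  have hcycle_int : Integrable (fun ω => PCTSP.cycleLength c (C ω)) P :=
    integrable_of_le_of_le hC_meas.aestronglyMeasurable
      (ae_of_all P fun ω => PCTSP.cycleLength_nonneg hc (C ω)) hbound (integrable_zero _ _ P)
      hbound_int
  have hcore_le := hμ.integral_coreBound_le hc.nonneg hδ₁ hκ₁ hT₀ hT₀_law hγ hγ_cdf hind (b := b)
    fun S hS hpos e he => ⟨hμ.le_y_of_mem_verts hy hS hpos
      (hpeak S hS e (PCTSP.mem_subEdges.1 he)).1, hμ.y_le_one _⟩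
  refine ⟨hcycle_int, (integral_mono_ae hcycle_int hbound_int hbound).trans ?_⟩
  rw [integral_add (integrable_const _) hcore, integral_const, probReal_univ, one_smul]
  linear_combination hcore_le

theorem lemma4 {V : Type*} [Fintype V] [DecidableEq V] (r : V)
    (c : Sym2 V → ℝ) (hc : PCTSP.IsMetric c)
    (δ κ : ℝ) (hδ₀ : 0 ≤ δ) (hδ₁ : δ < 1) (hδκ : δ ≤ κ) (hκ₁ : κ ≤ 1)
    -- the initial solution of the relaxation and the one obtained from it by splitting off
    (xs : Sym2 V → ℝ) (ys : V → ℝ) (hs : PCTSP.Feasible r xs ys)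
    (x : Sym2 V → ℝ) (y : V → ℝ) (hxy : PCTSP.ObtainedBySplitting r δ xs ys x y)
    -- the tree decomposition of the latter
    (𝒯 : Finset (PCTSP.Subgr V)) (μ : PCTSP.Subgr V → ℝ)
    (hμ : PCTSP.IsTreeDecomposition r x y 𝒯 μ)
    -- the random tree and the independent random threshold
    {Ω : Type*} [MeasurableSpace Ω] (P : MeasureTheory.Measure Ω)
    [MeasureTheory.IsProbabilityMeasure P]
    (T₀ : Ω → PCTSP.Subgr V) (hT₀ : Measurable T₀)
    (hT₀_law : ∀ T ∈ 𝒯, P.real {ω | T₀ ω = T} = μ T)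
    (γ : Ω → ℝ) (hγ : Measurable γ)
    (hγ_mem : ∀ᵐ ω ∂P, γ ω ∈ Set.Icc δ κ)
    (hγ_cdf : ∀ t ∈ Set.Icc δ κ, P.real {ω | γ ω ≤ t} = (3 - δ - κ) / (3 - δ - t))
    (hind : ProbabilityTheory.IndepFun T₀ γ P)
    -- the core and the cycle constructed from it
    (T : Ω → PCTSP.Subgr V) (hT : ∀ᵐ ω ∂P, PCTSP.IsCore y (T₀ ω) (γ ω) (T ω))
    (C : Ω → List V) (hC : ∀ᵐ ω ∂P, PCTSP.IsCorrectedCycle c (T ω) (C ω))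
    (hC_meas : AEMeasurable (fun ω => PCTSP.cycleLength c (C ω)) P) :
    MeasureTheory.Integrable (fun ω => PCTSP.cycleLength c (C ω)) P ∧
      ∫ ω, PCTSP.cycleLength c (C ω) ∂P ≤
        (7 - 2 * δ - 2 * κ) / (3 - δ) * PCTSP.cost c xs := by
  obtain ⟨hcycle_int, hle⟩ := lemma4_general r c hc δ κ hδ₁.le hκ₁ x y (hxy.feasible hs).cuts
    hxy.eq_zero_or_le 𝒯 μ hμ P T₀ hT₀ hT₀_law γ hγ (hγ_mem.mono fun _ hω => hω.2.trans hκ₁)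
    (fun t ht => (hγ_cdf t ht).le) hind T hT C hC hC_meas
  exact ⟨hcycle_int, hle.trans (mul_le_mul_of_nonneg_left (hxy.cost_le hc)
    (div_nonneg (by linarith) (by linarith)))⟩
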